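/- A point cloud is a tuple $P=(p_1,\dots,p_n)\in\mathbb{R}^{n\times 3}$ with $n\ge 1$ (points may coincide); write $d_{ij}=\lVert p_i-p_j\rVert$. Point clouds $P,P'$ are isomorphic if they have the same number $n$ of points and there are a permutation $\sigma$ of $\{1,\dots,n\}$, $R\in O(3)$ and $t\in\mathbb{R}^3$ with $p'_{\sigma(i)}=Rp_i+t$ for all $i$. A map $f$ from point clouds to $\mathbb{R}^k$ is E(3)-complete if $f(P)=f(P')$ whenever $P,P'$ are isomorphic and $f(P)\ne f(P')$ whenever they are not. A GeoNGNN with $N_{\mathrm{in}}\ge 0$ inner layers, $N_{\mathrm{out}}\ge 0$ outer layers, subgraph radius $r_{\mathrm{sub}}\in[0,\infty]$ and cutoff $r_{\mathrm{cutoff}}\in[0,\infty]$ computes, with $\mathcal{N}(j)=\{k : d_{kj}\le r_{\mathrm{cutoff}}\}$ (so $j\in\mathcal N(j)$) and raw node features $x_j$, $$h_{ij}^{(0)}=f_{\mathrm{init}}\bigl(x_j,d_{ij},\mathbb{1}_{i=j}\bigr),\qquad h_{ij}^{(l+1)}=f_{\mathrm{upd,in}}^{(l)}\Bigl(h_{ij}^{(l)},\,f_{\mathrm{aggr,in}}^{(l)}\bigl(\{\!\{(h_{ik}^{(l)},d_{kj})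 : k\in\mathcal{N}(j),\ d_{ik}\le r_{\mathrm{sub}}\}\!\}\bigr)\Bigr)$$ for $d_{ij}\le r_{\mathrm{sub}}$ and $0\le l<N_{\mathrm{in}}$; then $$h_i^{(0)}=f_{\mathrm{output,in}}\bigl(\{\!\{h_{ij}^{(N_{\mathrm{in}})} : d_{ij}\le r_{\mathrm{sub}}\}\!\}\bigr),\qquad h_i^{(l+1)}=f_{\mathrm{upd,out}}^{(l)}\Bigl(h_i^{(l)},\,f_{\mathrm{aggr,out}}^{(l)}\bigl(\{\!\{(h_j^{(l)},d_{ij}) : j\in\mathcal{N}(i)\}\!\}\bigr)\Bigr)$$ for $0\le l<N_{\mathrm{out}}$; and finally outputs $f_{\mathrm{out}}\bigl(\{\!\{h_i^{(N_{\mathrm{out}})} : 1\le i\le n\}\!\}\bigr)\in\mathbb{R}^k$. Here $\{\!\{\cdot\}\!\}$ denotes a multiset, and all hidden representations are real vectors whose dimensions may depend on the layer. On unlabeled point clouds all $x_j$ equal one fixed vector. Theorem. Suppose that all the functions $f$ above that the model uses are injective (each on its whole domain, the aggregation and pooling functions being defined on all finite multisets), that $N_{\mathrm{in}}\ge 5$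 and $N_{\mathrm{out}}\ge 0$, that $r_{\mathrm{cutoff}}=+\infty$ (the distance graph is fully connected), and that $r_{\mathrm{sub}}=+\infty$ (all subgraphs are the original graph). Then this GeoNGNN, as a map on unlabeled point clouds, is E(3)-complete. -/

import Mathlib

open scoped NNReal ENNReal

noncomputable section

/-- Three-dimensional Euclidean space. -/
abbrev E3 : Type := EuclideanSpace ℝ (Fin 3)

/-- An unlabeled point cloud: an element of `⋃ n ≥ 1, ℝ^{n × 3}`. Points may coincide. -/
structure PointCloud where
  /-- number of nodes -/
  n : ℕ
  n_pos : 0 < n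
  /-- coordinates of the nodes -/
  pos : Fin n → E3

namespace PointCloud

/-- The Euclidean distance between nodes `i` and `j`. -/
def d (P : PointCloud) (i j : Fin P.n) : ℝ≥0 := nndist (P.pos i) (P.pos j)

/-- `P` and `Q` are isomorphic: up to a bijective relabeling `σ` of the nodes they differ by an
orthogonal map `R` (an element of `O(3)`, possibly a reflection) followed by a translation. -/
def Isomorphic (P Q : PointCloud) : Prop :=
  ∃ (σ : Fin P.n ≃ Fin Q.n) (R : E3 ≃ₗᵢ[ℝ] E3) (t : E3),
    ∀ i, Q.pos (σ i) = R (P.pos i) + t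

end PointCloud

/-- Invariance under permutations of the nodes and under E(3). -/
def IsE3Invariant {k : ℕ} (f : PointCloud → (Fin k → ℝ)) : Prop :=
  ∀ P Q : PointCloud, P.Isomorphic Q → f P = f Q

/-- `f` is E(3)-complete: it is permutation- and E(3)-invariant, and any two non-isomorphic point
clouds have different representations. -/
def IsE3Complete {k : ℕ} (f : PointCloud → (Fin k → ℝ)) : Prop :=
  IsE3Invariant f ∧ ∀ P Q : PointCloud, ¬ P.Isomorphic Q → f P ≠ f Q

/-- A GeoNGNN (a DisGNN nested into a DisGNN, with marking of the root of each subgraph): its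
hyperparameters and intermediate functions. Raw node features lie in `ℝ^dx`, the cloud-level
representation lies in `ℝ^k`, and every layer has its own hidden dimension.
The functions indexed by a layer `l` are used only for `l < nIn`, respectively `l < nOut`. -/
structure GeoNGNN (dx k : ℕ) where
  /-- number of inner layers -/
  nIn : ℕ
  /-- number of outer layers; `0` means that the outer GNN only performs the final pooling -/
  nOut : ℕ
  /-- subgraph radius -/
  rSub : ℝ≥0∞
  /-- interaction cutoff -/
  rCutoff : ℝ≥0∞
  /-- dimension of the inner node representations after `l` layers -/
  dIn : ℕ → ℕ
  /-- dimension of the aggregated inner messages at layer `l` -/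
  aIn : ℕ → ℕ
  /-- dimension of the outer node representations after `l` layers -/
  dOut : ℕ → ℕ
  /-- dimension of the aggregated outer messages at layer `l` -/
  aOut : ℕ → ℕ
  /-- arguments: raw feature of `j`, distance `d i j`, root mark (whether `i = j`) -/
  initInner : (Fin dx → ℝ) × ℝ≥0 × Bool → (Fin (dIn 0) → ℝ)
  aggrInner : (l : ℕ) → Multiset ((Fin (dIn l) → ℝ) × ℝ≥0) → (Fin (aIn l) → ℝ)
  updateInner : (l : ℕ) → (Fin (dIn l) → ℝ) × (Fin (aIn l) → ℝ) → (Fin (dIn (l + 1)) → ℝ)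
  outputInner : Multiset (Fin (dIn nIn) → ℝ) → (Fin (dOut 0) → ℝ)
  aggrOuter : (l : ℕ) → Multiset ((Fin (dOut l) → ℝ) × ℝ≥0) → (Fin (aOut l) → ℝ)
  updateOuter : (l : ℕ) → (Fin (dOut l) → ℝ) × (Fin (aOut l) → ℝ) → (Fin (dOut (l + 1)) → ℝ)
  /-- final pooling over the nodes of the cloud -/
  output : Multiset (Fin (dOut nOut) → ℝ) → (Fin k → ℝ)

namespace GeoNGNN

variable {dx k : ℕ} (M : GeoNGNN dx k)

/-- The maximally expressive form of the model: every intermediate function that the model uses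
is injective. -/
structure AllInjective : Prop where
  initInner : Function.Injective M.initInner
  aggrInner : ∀ l < M.nIn, Function.Injective (M.aggrInner l)
  updateInner : ∀ l < M.nIn, Function.Injective (M.updateInner l)
  outputInner : Function.Injective M.outputInner
  aggrOuter : ∀ l < M.nOut, Function.Injective (M.aggrOuter l)
  updateOuter : ∀ l < M.nOut, Function.Injective (M.updateOuter l)
  output : Function.Injective M.output

variable (P : PointCloud) (X : Fin P.n → (Fin dx → ℝ))

/-- The neighbors of `j` in the distance graph, `j` itself included. -/
def nbhd (j : Fin P.n) : Finset (Fin P.n) :=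
  Finset.univ.filter fun k => (P.d k j : ℝ≥0∞) ≤ M.rCutoff

/-- The nodes of the sub-point cloud around `i`. -/
def sub (i : Fin P.n) : Finset (Fin P.n) :=
  Finset.univ.filter fun j => (P.d i j : ℝ≥0∞) ≤ M.rSub

/-- The representation of node `j` in the sub-point cloud of node `i` after `l` inner layers
(meaningful for `j ∈ M.sub P i`, and used only for such `j`). -/
def inner : (l : ℕ) → (i j : Fin P.n) → (Fin (M.dIn l) → ℝ)
  | 0, i, j => M.initInner (X j, P.d i j, decide (i = j))
  | l + 1, i, j =>
      M.updateInner l (inner l i j,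
        M.aggrInner l ((M.nbhd P j ∩ M.sub P i).val.map fun k => (inner l i k, P.d k j)))

/-- The representation of node `i` after `l` outer layers, starting from the summary of the
sub-point cloud of `i`. -/
def outer : (l : ℕ) → (i : Fin P.n) → (Fin (M.dOut l) → ℝ)
  | 0, i => M.outputInner ((M.sub P i).val.map fun j => M.inner P X M.nIn i j)
  | l + 1, i =>
      M.updateOuter l (outer l i,
        M.aggrOuter l ((M.nbhd P i).val.map fun j => (outer l j, P.d i j)))

/-- The cloud-level representation of the point cloud `P` with node features `X`. -/
def eval : Fin k → ℝ :=
  M.output ((Finset.univ : Finset (Fin P.n)).val.map fun i => M.outer P X M.nOut i)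

/-- The model on unlabeled point clouds: every node carries the same raw feature `x₀`
(for `dx = 0` there is no raw feature at all). -/
def onUnlabeled (x₀ : Fin dx → ℝ) (P : PointCloud) : Fin k → ℝ :=
  M.eval P fun _ => x₀

end GeoNGNN

end

open scoped RealInnerProductSpace

/-! Invariance holds because the model sees only distances. For completeness, injectivity lets every
layer be undone: equal states of two nodes after `l + 1` inner layers give a relabeling that keeps
all states after `l` layers and the distances to the two nodes.

Measured from the center of mass, one inner layer fixes the norm of each point, since the sum of its
squared distances is `n` times its squared norm plus a constant of the cloud. Distances thus become
inner products. Take a root `a` off the center, a point `u` off the line of `a` and, among the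
points outside the plane of `a, u`, a point `v` with the smallest dihedral angle to `u` along `a`.
(If no such `u` or `v` exists, norms and inner products already determine the points.) Level three
at `u` gives a relabeling that preserves norms and products with `a, u`; level two at `v` gives one
for `a, v`. Once the clouds are aligned on `a, u, v`, the difference of their multiplicities is
therefore odd under the mirrors in the planes `a, u` and `a, v`, and it vanishes in the open wedge
between them by the choice of `v`. By `eq_zero_of_mirror_odd` it is zero.
`exists_isometry_of_refinement` assembles this; three inner layers suffice. -/

/-! ### Equal multisets and relabelings -/

theorem exists_equiv_of_card_fiber_eq {ι κ E : Type*} [Fintype ι] [Fintype κ] [DecidableEq E]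
    {f : ι → E} {g : κ → E}
    (h : ∀ x, Fintype.card {i // f i = x} = Fintype.card {j // g j = x}) :
    ∃ ρ : ι ≃ κ, ∀ i, g (ρ i) = f i :=
  ⟨Equiv.ofFiberEquiv fun x => Fintype.equivOfCardEq (h x), fun i => Equiv.ofFiberEquiv_map _ i⟩

theorem exists_equiv_of_map_univ_eq {ι κ E : Type*} [Fintype ι] [Fintype κ]
    {f : ι → E} {g : κ → E}
    (h : (Finset.univ : Finset ι).val.map f = (Finset.univ : Finset κ).val.map g) :
    ∃ ρ : ι ≃ κ, ∀ i, g (ρ i) = f i := by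
  classical
  refine exists_equiv_of_card_fiber_eq fun x => ?_
  have key := congrArg (Multiset.count x) h
  rw [Multiset.count_map, Multiset.count_map] at key
  rw [Fintype.card_subtype, Fintype.card_subtype]
  simpa [Finset.card_def, eq_comm] using key

theorem map_univ_eq_of_equiv {ι κ E : Type*} [Fintype ι] [Fintype κ]
    {f : ι → E} {g : κ → E} (ρ : ι ≃ κ) (h : ∀ i, g (ρ i) = f i) :
    (Finset.univ : Finset ι).val.map f = (Finset.univ : Finset κ).val.map g := by
  rw [← Multiset.map_univ_val_equiv ρ, Multiset.map_map]
  exact Multiset.map_congr rfl fun i _ => (h i).symm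

/-! ### Isometries from Gram data -/

section Geometry

variable {V : Type*} [NormedAddCommGroup V] [InnerProductSpace ℝ V]

/-- Linear maps with pointwise equal norms differ by a linear isometry of the target. -/
theorem exists_linearIsometryEquiv_of_norm_eq [FiniteDimensional ℝ V] {M : Type*} [AddCommGroup M]
    [Module ℝ M] (X Y : M →ₗ[ℝ] V) (hn : ∀ c, ‖X c‖ = ‖Y c‖) :
    ∃ R : V ≃ₗᵢ[ℝ] V, ∀ c, R (X c) = Y c := by
  have hker : LinearMap.ker X ≤ LinearMap.ker Y := fun c hc => by
    rw [LinearMap.mem_ker] at hc ⊢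
    rw [← norm_eq_zero, ← hn, hc, norm_zero]
  obtain ⟨T, hT⟩ : ∃ T : LinearMap.range X →ₗ[ℝ] V,
      ∀ c, T ⟨X c, LinearMap.mem_range_self X c⟩ = Y c := by
    refine ⟨(LinearMap.ker X).liftQ Y hker ∘ₗ X.quotKerEquivRange.symm.toLinearMap, fun c => ?_⟩
    rw [LinearMap.comp_apply, LinearEquiv.coe_coe, LinearMap.quotKerEquivRange_symm_apply_image]
    rfl
  let L : LinearMap.range X →ₗᵢ[ℝ] V :=
    ⟨T, by
      rintro ⟨_, c, rfl⟩
      exact (congrArg norm (hT c)).trans (hn c).symm⟩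
  refine ⟨L.extend.toLinearIsometryEquiv rfl, fun c => ?_⟩
  rw [LinearIsometry.toLinearIsometryEquiv_apply, ← hT]
  exact LinearIsometry.extend_apply L ⟨X c, LinearMap.mem_range_self X c⟩

/-- Vectors with the same Gram matrix differ by a linear isometry. -/
theorem exists_linearIsometryEquiv_of_inner_eq [FiniteDimensional ℝ V] {ι : Type*} [Fintype ι]
    {x y : ι → V} (h : ∀ i j, ⟪x i, x j⟫ = ⟪y i, y j⟫) :
    ∃ R : V ≃ₗᵢ[ℝ] V, ∀ i, R (x i) = y i := by
  classical
  obtain ⟨R, hR⟩ := exists_linearIsometryEquiv_of_norm_eq (Fintype.linearCombination ℝ x)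
    (Fintype.linearCombination ℝ y) fun c => by
      rw [← sq_eq_sq₀ (norm_nonneg _) (norm_nonneg _), ← real_inner_self_eq_norm_sq,
        ← real_inner_self_eq_norm_sq]
      simp only [Fintype.linearCombination_apply, sum_inner, inner_sum, inner_smul_left,
        inner_smul_right, h]
  refine ⟨R, fun i => ?_⟩
  have := hR (Pi.single i 1)
  rwa [Fintype.linearCombination_apply_single, Fintype.linearCombination_apply_single, one_smul,
    one_smul] at this

/-- A point of the span of `S` is determined by its norm and its inner products with `S`. -/
theorem eq_of_inner_eq_of_mem_span {S : Set V} {x y : V} (hx : x ∈ Submodule.span ℝ S)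
    (hnorm : ‖y‖ = ‖x‖) (h : ∀ s ∈ S, ⟪y, s⟫ = ⟪x, s⟫) : y = x := by
  have hz : ∀ z ∈ Submodule.span ℝ S, ⟪y, z⟫ = ⟪x, z⟫ := fun z hz => by
    induction hz using Submodule.span_induction with
    | mem s hs => exact h s hs
    | zero => simp
    | add a b _ _ ha hb => rw [inner_add_right, inner_add_right, ha, hb]
    | smul c a _ ha => rw [inner_smul_right, inner_smul_right, ha]
  rw [← sub_eq_zero, ← norm_eq_zero, ← sq_eq_zero_iff, norm_sub_sq_real, hz x hx, hnorm,
    real_inner_self_eq_norm_sq]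
  ring

/-! ### Mirrors and odd functions -/

theorem exists_inner_pos_of_notMem {W : Submodule ℝ V} [W.HasOrthogonalProjection] {v : V}
    (hv : v ∉ W) : ∃ n : V, (∀ w ∈ W, ⟪w, n⟫ = 0) ∧ 0 < ⟪v, n⟫ := by
  have hmem : v - W.starProjection v ∈ Wᗮ := W.sub_starProjection_mem_orthogonal v
  refine ⟨v - W.starProjection v, fun w hw => hmem w hw, ?_⟩
  have h0 : ⟪W.starProjection v, v - W.starProjection v⟫ = 0 :=
    hmem _ (W.starProjection_apply_mem v)
  have hne : v - W.starProjection v ≠ 0 := fun h => hv <| by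
    rw [sub_eq_zero.1 h]; exact W.starProjection_apply_mem v
  have : ⟪v, v - W.starProjection v⟫ = ⟪v - W.starProjection v, v - W.starProjection v⟫ := by
    rw [inner_sub_left v (W.starProjection v) (v - W.starProjection v), h0, sub_zero]
  rw [this]
  exact real_inner_self_pos.2 hne

/-- The reflection in the hyperplane orthogonal to `n`. -/
noncomputable def mirror (n x : V) : V := x - (2 * ⟪x, n⟫ / ⟪n, n⟫) • n

theorem inner_mirror (n x w : V) :
    ⟪mirror n x, w⟫ = ⟪x, w⟫ - 2 * ⟪x, n⟫ / ⟪n, n⟫ * ⟪n, w⟫ := by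
  rw [mirror, inner_sub_left, inner_smul_left]; simp

theorem mirror_eq_self {n x : V} (h : ⟪x, n⟫ = 0) : mirror n x = x := by simp [mirror, h]

/-- A finitely supported function that is odd under two mirrors and vanishes on the open wedge
between them is zero. -/
theorem eq_zero_of_mirror_odd {D : V → ℤ} (hfin : D.support.Finite) {n m w : V}
    (hn : ∀ x, D x + D (mirror n x) = 0) (hm : ∀ x, D x + D (mirror m x) = 0)
    (hnw : 0 < ⟪n, w⟫) (hmw : 0 < ⟪m, w⟫)
    (hD : ∀ x, 0 < ⟪x, n⟫ → 0 < ⟪x, m⟫ → D x = 0) : D = 0 := by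
  by_contra hne
  have hs : D.support.Nonempty := Function.support_nonempty_iff.2 hne
  -- Take a support point extreme in the direction `w`. From the negative side of a mirror its
  -- image, also in the support, would lie further along `w`; on the mirror, oddness gives `2 * D x
  -- = 0`. So it lies in the wedge.
  obtain ⟨x, hx, hmax⟩ := Set.exists_max_image D.support (fun x => ⟪x, w⟫) hfin hs
  have main : ∀ l : V, (∀ x, D x + D (mirror l x) = 0) → 0 < ⟪l, w⟫ → 0 < ⟪x, l⟫ := by
    intro l hl hlw
    have hl0 : l ≠ 0 := by rintro rfl; simp at hlw
    have hll : 0 < ⟪l, l⟫ := real_inner_self_pos.2 hl0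
    rcases lt_trichotomy ⟪x, l⟫ 0 with h | h | h
    · have hmem : mirror l x ∈ D.support := fun h0 => hx (by have := hl x; omega)
      have h1 := hmax _ hmem
      simp only [inner_mirror] at h1
      have : 2 * ⟪x, l⟫ / ⟪l, l⟫ * ⟪l, w⟫ < 0 :=
        mul_neg_of_neg_of_pos (div_neg_of_neg_of_pos (by linarith) hll) hlw
      linarith
    · refine absurd ?_ hx
      have := hl x
      rw [mirror_eq_self h] at this
      omega
    · exact h
  exact hx (hD x (main n hn hnw) (main m hm hmw))

/-- The points with prescribed norm and prescribed inner products with a hyperplane are mirror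
images of each other. -/
theorem eq_or_eq_mirror {n x y : V} {t : ℝ} (hn : n ≠ 0) (hnorm : ‖y‖ = ‖x‖)
    (h : y - x = t • n) : y = x ∨ y = mirror n x := by
  obtain rfl : y = x + t • n := by rw [← h]; abel
  have hnn : ⟪n, n⟫ ≠ 0 := (real_inner_self_pos.2 hn).ne'
  have h1 : ⟪x + t • n, x + t • n⟫ = ⟪x, x⟫ := by
    rw [real_inner_self_eq_norm_sq, real_inner_self_eq_norm_sq, hnorm]
  have h2 : t * (2 * ⟪x, n⟫ + t * ⟪n, n⟫) = 0 := by
    simp only [inner_add_left, inner_add_right, inner_smul_left, inner_smul_right,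
      real_inner_comm x n, conj_trivial] at h1
    linarith
  rcases mul_eq_zero.1 h2 with h3 | h3
  · left; simp [h3]
  · right
    have : t = -(2 * ⟪x, n⟫ / ⟪n, n⟫) := by field_simp; linarith
    rw [mirror, this, neg_smul, sub_eq_add_neg]

/-! ### Differences of multiplicities -/

section Count

variable {V ι κ : Type*} [Fintype ι] [Fintype κ]

open Classical in
/-- The difference of the multiplicities of `x` in the families `p` and `q`. -/
noncomputable def multDiff (p : ι → V) (q : κ → V) (x : V) : ℤ :=
  (Fintype.card {i // p i = x} : ℤ) - Fintype.card {j // q j = x}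

theorem multDiff_eq_zero {p : ι → V} {q : κ → V} {x : V} (hp : ∀ i, p i ≠ x)
    (hq : ∀ j, q j ≠ x) : multDiff p q x = 0 := by
  classical
  have h1 : IsEmpty {i // p i = x} := ⟨fun i => hp i i.2⟩
  have h2 : IsEmpty {j // q j = x} := ⟨fun j => hq j j.2⟩
  simp [multDiff]

theorem finite_support_multDiff (p : ι → V) (q : κ → V) : (multDiff p q).support.Finite := by
  refine ((Set.finite_range p).union (Set.finite_range q)).subset fun x hx => ?_
  by_contra hx'
  simp only [Set.mem_union, Set.mem_range, not_or, not_exists] at hx'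
  exact hx (multDiff_eq_zero hx'.1 hx'.2)

theorem card_fiber_add [DecidableEq V] (p : ι → V) {x y : V} (h : x ≠ y) :
    Fintype.card {i // p i = x} + Fintype.card {i // p i = y}
      = Fintype.card {i // p i = x ∨ p i = y} :=
  (Fintype.card_subtype_or_disjoint _ _ (by
    rw [Pi.disjoint_iff]
    intro i
    simp only [Prop.disjoint_iff]
    rintro ⟨h1, h2⟩
    exact h (h1.symm.trans h2))).symm

theorem multDiff_add_eq_zero {p : ι → V} {q : κ → V} (σ : ι ≃ κ) {x y : V}
    (h : ∀ i, (p i = x ∨ p i = y) ↔ (q (σ i) = x ∨ q (σ i) = y)) :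
    multDiff p q x + multDiff p q y = 0 := by
  classical
  have hcard : Fintype.card {i // p i = x ∨ p i = y}
      = Fintype.card {j // q j = x ∨ q j = y} :=
    Fintype.card_congr (σ.subtypeEquiv h)
  by_cases hx : x = y
  · rw [← hx] at hcard ⊢
    simp only [or_self] at hcard
    simp [multDiff, hcard]
  · rw [← card_fiber_add p hx, ← card_fiber_add q hx] at hcard
    simp only [multDiff]
    omega

end Count

/-- Two families that agree, up to relabeling, in the norm and in the inner products with a basis of
a hyperplane have the same number of points in each mirror pair of this hyperplane. -/
theorem multDiff_mirror_odd {ι κ : Type*} [Fintype ι] [Fintype κ] {p : ι → V} {q : κ → V}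
    {n : V} (hn : n ≠ 0) {S : Set V} (hS : ∀ s ∈ S, ⟪s, n⟫ = 0)
    (hspan : ∀ z : V, (∀ s ∈ S, ⟪z, s⟫ = 0) → ∃ t : ℝ, z = t • n) (σ : ι ≃ κ)
    (hnorm : ∀ i, ‖q (σ i)‖ = ‖p i‖) (hinner : ∀ i, ∀ s ∈ S, ⟪q (σ i), s⟫ = ⟪p i, s⟫) (x : V) :
    multDiff p q x + multDiff p q (mirror n x) = 0 := by
  have hnn : ⟪n, n⟫ ≠ 0 := (real_inner_self_pos.2 hn).ne'
  -- A mirror pair is where a sphere about `0` meets a line parallel to `n`, so it is a level set of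
  -- the data that `σ` preserves.
  have key : ∀ y, (y = x ∨ y = mirror n x) ↔ (‖y‖ = ‖x‖ ∧ ∀ s ∈ S, ⟪y, s⟫ = ⟪x, s⟫) := by
    intro y
    constructor
    · rintro (rfl | rfl)
      · exact ⟨rfl, fun _ _ => rfl⟩
      · refine ⟨?_, fun s hs => ?_⟩
        · rw [← sq_eq_sq₀ (norm_nonneg _) (norm_nonneg _), ← real_inner_self_eq_norm_sq,
            ← real_inner_self_eq_norm_sq, inner_mirror, real_inner_comm, inner_mirror,
            real_inner_comm (mirror n x) n, inner_mirror, real_inner_comm x n]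
          field_simp
          ring
        · rw [inner_mirror, real_inner_comm s n, hS s hs, mul_zero, sub_zero]
    · rintro ⟨h1, h2⟩
      obtain ⟨t, ht⟩ := hspan (y - x) fun s hs => by rw [inner_sub_left, h2 s hs, sub_self]
      exact eq_or_eq_mirror hn h1 ht
  refine multDiff_add_eq_zero σ fun i => ?_
  rw [key, key, hnorm]
  refine and_congr_right fun _ => forall₂_congr fun s hs => ?_
  rw [hinner i s hs]

/-! ### Dihedral angles -/

theorem abs_real_inner_lt_norm_mul_norm {x y : V} (hx : x ≠ 0) (h : ∀ c : ℝ, y ≠ c • x) :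
    |⟪x, y⟫| < ‖x‖ * ‖y‖ := by
  refine lt_of_le_of_ne (abs_real_inner_le_norm x y) fun heq => ?_
  have hy : y ≠ 0 := fun h0 => h 0 (by simp [h0])
  have h1 : |⟪x, y⟫ / (‖x‖ * ‖y‖)| = 1 := by
    rw [abs_div, heq, abs_of_nonneg (by positivity), div_self]
    have := norm_pos_iff.2 hx
    have := norm_pos_iff.2 hy
    positivity
  obtain ⟨-, r, -, hr⟩ := (abs_real_inner_div_norm_mul_norm_eq_one_iff x y).1 h1
  exact h r hr

/-- Inside the angle from `x` to `y` the directions are closer to `x` than `y` is. -/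
theorem inner_div_norm_lt_of_pos_comb {x y : V} (hx : x ≠ 0) (h : ∀ c : ℝ, y ≠ c • x) {α β : ℝ}
    (hα : 0 < α) (hβ : 0 < β) :
    ⟪y, x⟫ / ‖y‖ < ⟪α • x + β • y, x⟫ / ‖α • x + β • y‖ := by
  have hy : y ≠ 0 := fun h0 => h 0 (by simp [h0])
  have hz : α • x + β • y ≠ 0 := fun h0 => h (-(α / β)) <| by
    have h1 : β • y = -(α • x) := eq_neg_of_add_eq_zero_right h0
    rw [neg_smul, div_eq_inv_mul, mul_smul, ← smul_neg, ← h1, inv_smul_smul₀ hβ.ne']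
  have hcs := abs_real_inner_lt_norm_mul_norm hx h
  rw [div_lt_div_iff₀ (norm_pos_iff.2 hy) (norm_pos_iff.2 hz)]
  -- With `z = α • x + β • y` and denominators cleared, the claim is `⟪x, y⟫ * (‖z‖ - β * ‖y‖) < α *
  -- ‖x‖ ^ 2 * ‖y‖`: strict Cauchy–Schwarz bounds the first factor, the triangle inequality the
  -- second.
  have htri : |‖α • x + β • y‖ - β * ‖y‖| ≤ α * ‖x‖ := by
    have h1 := abs_norm_sub_norm_le (α • x + β • y) (β • y)
    rwa [add_sub_cancel_right, norm_smul, norm_smul, Real.norm_of_nonneg hα.le,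
      Real.norm_of_nonneg hβ.le] at h1
  have hxpos := norm_pos_iff.2 hx
  have hprod : |⟪x, y⟫ * (‖α • x + β • y‖ - β * ‖y‖)| < (‖x‖ * ‖y‖) * (α * ‖x‖) := by
    rw [abs_mul]
    exact mul_lt_mul_of_lt_of_le_of_nonneg_of_pos hcs htri (abs_nonneg _) (by positivity)
  have h2 := (abs_lt.1 hprod).2
  rw [inner_add_left, inner_smul_left, inner_smul_left, real_inner_self_eq_norm_sq,
    real_inner_comm x y]
  simp only [conj_trivial]
  nlinarith

/-- The component of `x` orthogonal to `a`. -/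
noncomputable def rej (a x : V) : V := x - (⟪x, a⟫ / ⟪a, a⟫) • a

theorem inner_rej (a x y : V) :
    ⟪rej a x, rej a y⟫ = ⟪x, y⟫ - ⟪x, a⟫ * ⟪y, a⟫ / ⟪a, a⟫ := by
  by_cases ha : a = 0
  · simp [rej, ha]
  have : ⟪a, a⟫ ≠ 0 := (real_inner_self_pos.2 ha).ne'
  simp only [rej, inner_sub_left, inner_sub_right, inner_smul_left, inner_smul_right,
    conj_trivial, real_inner_comm y a]
  field_simp
  ring

theorem rej_comb {a : V} (ha : a ≠ 0) (s α β : ℝ) (u v : V) :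
    rej a (s • a + α • u + β • v) = α • rej a u + β • rej a v := by
  have : ⟪a, a⟫ ≠ 0 := (real_inner_self_pos.2 ha).ne'
  have h : ⟪s • a + α • u + β • v, a⟫ / ⟪a, a⟫
      = s + α * (⟪u, a⟫ / ⟪a, a⟫) + β * (⟪v, a⟫ / ⟪a, a⟫) := by
    simp only [inner_add_left, inner_smul_left, conj_trivial]
    field_simp
  rw [rej, rej, rej, h]
  module

/-- The cosine of the dihedral angle along the axis `a` between `u` and `x`, up to the
factor `‖rej a u‖`. -/
noncomputable def dihedral (a u x : V) : ℝ := ⟪rej a x, rej a u⟫ / ‖rej a x‖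

theorem norm_rej_eq {a x y : V} (hnorm : ‖y‖ = ‖x‖) (ha : ⟪y, a⟫ = ⟪x, a⟫) :
    ‖rej a y‖ = ‖rej a x‖ := by
  rw [← sq_eq_sq₀ (norm_nonneg _) (norm_nonneg _), ← real_inner_self_eq_norm_sq,
    ← real_inner_self_eq_norm_sq, inner_rej, inner_rej, real_inner_self_eq_norm_sq y,
    real_inner_self_eq_norm_sq x, hnorm, ha]

theorem dihedral_eq {a u x y : V} (hnorm : ‖y‖ = ‖x‖) (ha : ⟪y, a⟫ = ⟪x, a⟫)
    (hu : ⟪y, u⟫ = ⟪x, u⟫) : dihedral a u y = dihedral a u x := by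
  rw [dihedral, dihedral, norm_rej_eq hnorm ha, inner_rej, inner_rej, ha, hu]

/-- Removing the component along `a` kills `s • a` and reduces the wedge to a plane angle, where
`inner_div_norm_lt_of_pos_comb` applies. -/
theorem dihedral_lt {a u v : V} (ha : a ≠ 0) (hu : u ∉ Submodule.span ℝ {a})
    (hv : v ∉ Submodule.span ℝ {a, u}) {s α β : ℝ} (hα : 0 < α) (hβ : 0 < β) :
    dihedral a u v < dihedral a u (s • a + α • u + β • v) := by
  rw [dihedral, dihedral, rej_comb ha]
  refine inner_div_norm_lt_of_pos_comb (fun h => hu ?_) (fun c h => hv ?_) hα hβ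
  · rw [Submodule.mem_span_singleton]
    exact ⟨_, (sub_eq_zero.1 h).symm⟩
  · rw [Submodule.mem_span_pair]
    refine ⟨⟪v, a⟫ / ⟪a, a⟫ - c * (⟪u, a⟫ / ⟪a, a⟫), c, ?_⟩
    generalize hb : ⟪v, a⟫ / ⟪a, a⟫ = b
    rw [rej, rej, hb, sub_eq_iff_eq_add] at h
    rw [h]
    module

/-- A finite family in 3-space is determined by the following data: the norms of its
points together with their inner products with `a, u`, and with `a, v`, separately,
provided that no point lies in the open wedge along the axis `a` between `u` and `v`. -/
theorem exists_equiv_of_dihedral_max [FiniteDimensional ℝ V] {ι κ : Type*} [Fintype ι] [Fintype κ]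
    {p : ι → V} {q : κ → V} {a u v : V} (ha : a ≠ 0) (hu : u ∉ Submodule.span ℝ {a})
    (hv : v ∉ Submodule.span ℝ {a, u}) (hspan : ∀ x, x ∈ Submodule.span ℝ {a, u, v})
    (hmax : ∀ i, p i ∉ Submodule.span ℝ {a, u} → dihedral a u (p i) ≤ dihedral a u v)
    (σ τ : ι ≃ κ)
    (hσ : ∀ i, ‖q (σ i)‖ = ‖p i‖ ∧ ⟪q (σ i), a⟫ = ⟪p i, a⟫ ∧ ⟪q (σ i), u⟫ = ⟪p i, u⟫)
    (hτ : ∀ i, ‖q (τ i)‖ = ‖p i‖ ∧ ⟪q (τ i), a⟫ = ⟪p i, a⟫ ∧ ⟪q (τ i), v⟫ = ⟪p i, v⟫) :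
    ∃ ρ : ι ≃ κ, ∀ i, q (ρ i) = p i := by
  classical
  have hu' : u ∉ Submodule.span ℝ {a, v} := fun h => by
    obtain ⟨s, t, h⟩ := Submodule.mem_span_pair.1 h
    by_cases ht : t = 0
    · exact hu (Submodule.mem_span_singleton.2 ⟨s, by rw [← h, ht]; simp⟩)
    · refine hv (Submodule.mem_span_pair.2 ⟨-(t⁻¹ * s), t⁻¹, ?_⟩)
      rw [← h, smul_add, smul_smul, inv_smul_smul₀ ht]
      module
  -- `n` and `m` are normals of the two walls of the wedge, pointing into it.
  obtain ⟨n, hn, hvn⟩ := exists_inner_pos_of_notMem hv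
  obtain ⟨m, hm, hum⟩ := exists_inner_pos_of_notMem hu'
  have han := hn a (Submodule.subset_span (by simp))
  have hun := hn u (Submodule.subset_span (by simp))
  have ham := hm a (Submodule.subset_span (by simp))
  have hvm := hm v (Submodule.subset_span (by simp))
  have hn0 : n ≠ 0 := by rintro rfl; simp at hvn
  have hm0 : m ≠ 0 := by rintro rfl; simp at hum
  have horth : ∀ z, ⟪z, a⟫ = 0 → ⟪z, u⟫ = 0 → ⟪z, v⟫ = 0 → z = 0 := fun z h1 h2 h3 => by
    obtain ⟨r, s, t, h⟩ := Submodule.mem_span_triple.1 (hspan z)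
    rw [← inner_self_eq_zero (𝕜 := ℝ)]
    nth_rewrite 2 [← h]
    simp [inner_add_right, inner_smul_right, h1, h2, h3]
  have hline : ∀ {b c l : V}, ⟪a, l⟫ = 0 → ⟪b, l⟫ = 0 → 0 < ⟪c, l⟫ →
      (∀ z, ⟪z, a⟫ = 0 → ⟪z, b⟫ = 0 → ⟪z, c⟫ = 0 → z = 0) →
      ∀ z : V, (∀ s ∈ ({a, b} : Set V), ⟪z, s⟫ = 0) → ∃ t : ℝ, z = t • l := by
    intro b c l h1 h2 h3 h z hz
    refine ⟨⟪z, c⟫ / ⟪c, l⟫, sub_eq_zero.1 (h _ ?_ ?_ ?_)⟩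
    · rw [inner_sub_left, hz a (by simp), inner_smul_left, real_inner_comm a l, h1]; simp
    · rw [inner_sub_left, hz b (by simp), inner_smul_left, real_inner_comm b l, h2]; simp
    · rw [inner_sub_left, inner_smul_left, real_inner_comm c l]
      simp only [conj_trivial]
      field_simp
      ring
  have hwedge : ∀ x, 0 < ⟪x, n⟫ → 0 < ⟪x, m⟫ → dihedral a u v < dihedral a u x := by
    intro x hxn hxm
    obtain ⟨s, α, β, rfl⟩ := Submodule.mem_span_triple.1 (hspan x)
    -- Pairing with `n` isolates the coefficient of `v`, pairing with `m` that of `u`.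
    simp only [inner_add_left, inner_smul_left, conj_trivial, han, hun, ham, hvm, mul_zero,
      zero_add, add_zero] at hxn hxm
    exact dihedral_lt ha hu hv (pos_of_mul_pos_left hxm hum.le) (pos_of_mul_pos_left hxn hvn.le)
  have hD : multDiff p q = 0 := by
    refine eq_zero_of_mirror_odd (n := n) (m := m) (w := u + v) (finite_support_multDiff p q)
      (multDiff_mirror_odd hn0 (S := {a, u}) ?_ (hline han hun hvn horth) σ (fun i => (hσ i).1) ?_)
      (multDiff_mirror_odd hm0 (S := {a, v}) ?_
        (hline ham hvm hum fun z h1 h2 h3 => horth z h1 h3 h2) τ (fun i => (hτ i).1) ?_) ?_ ?_ ?_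
    · rintro s (rfl | rfl) <;> assumption
    · rintro i s (rfl | rfl)
      exacts [(hσ i).2.1, (hσ i).2.2]
    · rintro s (rfl | rfl) <;> assumption
    · rintro i s (rfl | rfl)
      exacts [(hτ i).2.1, (hτ i).2.2]
    · rw [real_inner_comm, inner_add_left, hun]; linarith
    · rw [real_inner_comm, inner_add_left, hvm]; linarith
    · intro x hxn hxm
      have hlt := hwedge x hxn hxm
      refine multDiff_eq_zero ?_ ?_
      · rintro i rfl
        exact hlt.not_ge (hmax i fun h => hxn.ne' (hn _ h))
      -- Points of `q` avoid the wedge too: `σ` preserves the dihedral angle, and it fixes the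
      -- position of any point in the plane of `a, u`.
      · intro j hj
        obtain ⟨i, rfl⟩ := σ.surjective j
        have hi : p i ∉ Submodule.span ℝ {a, u} := fun h => by
          have hqp : q (σ i) = p i := eq_of_inner_eq_of_mem_span h (hσ i).1 <| by
            rintro s (rfl | rfl)
            exacts [(hσ i).2.1, (hσ i).2.2]
          rw [← hj, hqp, hn _ h] at hxn
          exact lt_irrefl _ hxn
        rw [← hj, dihedral_eq (hσ i).1 (hσ i).2.1 (hσ i).2.2] at hlt
        exact hlt.not_ge (hmax i hi)
  refine exists_equiv_of_card_fiber_eq fun x => ?_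
  have := congrFun hD x
  simp only [multDiff, Pi.zero_apply] at this
  exact_mod_cast sub_eq_zero.1 this

end Geometry

/-! ### Reconstruction from a root and three levels -/

theorem span_insert_pair_eq_top {V : Type*} [NormedAddCommGroup V] [InnerProductSpace ℝ V]
    (hdim : Module.finrank ℝ V = 3) {a u v : V} (ha : a ≠ 0) (hu : u ∉ Submodule.span ℝ {a})
    (hv : v ∉ Submodule.span ℝ {a, u}) : Submodule.span ℝ {a, u, v} = ⊤ := by
  have hli : LinearIndependent ℝ ![v, u, a] := by
    refine linearIndependent_finCons.2 ⟨linearIndependent_finCons.2 ⟨?_, ?_⟩, ?_⟩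
    · simpa [linearIndependent_unique_iff] using ha
    · simpa using hu
    · simpa using hv
  have hs := hli.span_eq_top_of_card_eq_finrank (by simp [hdim])
  rw [← hs]
  congr 1
  ext x
  simp only [Set.mem_insert_iff, Set.mem_singleton_iff, Set.mem_range, Fin.exists_fin_succ,
    Matrix.cons_val_zero, Matrix.cons_val_succ, eq_comm (a := x)]
  simp
  tauto

/-- A finite family in 3-space is determined up to isometry by a root `i` and three levels of
refinement of the joint profile of norms and inner products with the root. -/
theorem exists_isometry_of_refinement {V : Type*} [NormedAddCommGroup V] [InnerProductSpace ℝ V]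
    [FiniteDimensional ℝ V] (hdim : Module.finrank ℝ V = 3)
    {ι κ : Type*} [Fintype ι] [Fintype κ] {p : ι → V} {q : κ → V} {i : ι}
    {L₁ L₂ L₃ : ι → κ → Prop} (σ₀ : ι ≃ κ) (hroot : p i ≠ 0 ∨ ∀ k, p k = 0)
    (h₁ : ∀ j j', L₁ j j' → ‖q j'‖ = ‖p j‖ ∧ ⟪q j', q (σ₀ i)⟫ = ⟪p j, p i⟫)
    (h₂ : ∀ j j', L₂ j j' → L₁ j j' ∧
      ∃ σ : ι ≃ κ, ∀ k, L₁ k (σ k) ∧ ⟪q (σ k), q j'⟫ = ⟪p k, p j⟫)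
    (h₃ : ∀ j j', L₃ j j' → L₂ j j' ∧
      ∃ σ : ι ≃ κ, ∀ k, L₂ k (σ k) ∧ ⟪q (σ k), q j'⟫ = ⟪p k, p j⟫)
    (hσ₀ : ∀ k, L₃ k (σ₀ k)) :
    ∃ (R : V ≃ₗᵢ[ℝ] V) (ρ : ι ≃ κ), ∀ k, q (ρ k) = R (p k) := by
  classical
  suffices h : ∃ (R : V ≃ₗᵢ[ℝ] V) (ρ : ι ≃ κ), ∀ k, R (q (ρ k)) = p k by
    obtain ⟨R, ρ, h⟩ := h
    exact ⟨R.symm, ρ, fun k => by rw [← h, R.symm_apply_apply]⟩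
  have h0 := fun k => h₁ _ _ (h₂ _ _ (h₃ _ _ (hσ₀ k)).1).1
  by_cases hline : ∀ k, p k ∈ Submodule.span ℝ {p i}
  · obtain ⟨R, hR⟩ := exists_linearIsometryEquiv_of_inner_eq
      (x := fun _ : Unit => q (σ₀ i)) (y := fun _ => p i) (fun _ _ => (h0 i).2)
    have hR := hR ()
    refine ⟨R, σ₀, fun k => eq_of_inner_eq_of_mem_span (hline k) ?_ ?_⟩
    · rw [R.norm_map, (h0 k).1]
    · rintro s rfl
      rw [← hR, R.inner_map_map, (h0 k).2, hR]
  push Not at hline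
  obtain ⟨j, hj⟩ := hline
  have hi : p i ≠ 0 := hroot.resolve_right fun h => hj (by rw [h j]; exact zero_mem _)
  obtain ⟨-, σ, hσ⟩ := h₃ _ _ (hσ₀ j)
  have hσ₁ := fun k => h₁ _ _ (h₂ _ _ (hσ k).1).1
  by_cases hplane : ∀ k, p k ∈ Submodule.span ℝ {p i, p j}
  · obtain ⟨R, hR⟩ := exists_linearIsometryEquiv_of_inner_eq
      (x := ![q (σ₀ i), q (σ₀ j)]) (y := ![p i, p j]) (by
        have e2 := (h0 j).2
        have e2' := e2
        have e3 := (h0 j).1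
        rw [real_inner_comm, real_inner_comm (p i)] at e2'
        simp [Fin.forall_fin_two, e2, e2', e3, (h0 i).1])
    have hRi : R (q (σ₀ i)) = p i := hR 0
    have hRj : R (q (σ₀ j)) = p j := hR 1
    refine ⟨R, σ, fun k => eq_of_inner_eq_of_mem_span (hplane k) ?_ ?_⟩
    · rw [R.norm_map, (hσ₁ k).1]
    · rintro s (rfl | rfl)
      · rw [← hRi, R.inner_map_map, (hσ₁ k).2, hRi]
      · rw [← hRj, R.inner_map_map, (hσ k).2, hRj]
  push Not at hplane
  -- The largest cosine is the smallest angle, so no `p k` lies strictly between the half-planes of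
  -- `p j` and `p m`.
  obtain ⟨m, hm, hmax⟩ := Finset.exists_max_image
    (Finset.univ.filter fun k => p k ∉ Submodule.span ℝ {p i, p j})
    (fun k => dihedral (p i) (p j) (p k)) (by simpa [Finset.Nonempty] using hplane)
  simp only [Finset.mem_filter, Finset.mem_univ, true_and] at hm hmax
  obtain ⟨-, τ, hτ⟩ := h₂ _ _ (hσ m).1
  -- The partner of `p m` is `q (σ m)`, not `q (σ₀ m)`: only `σ` is known to preserve the inner
  -- product with `p j`.
  obtain ⟨R, hR⟩ := exists_linearIsometryEquiv_of_inner_eq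
    (x := ![q (σ₀ i), q (σ₀ j), q (σ m)]) (y := ![p i, p j, p m]) (by
      have e2 := (h0 j).2
      have e3 := (hσ₁ m).2
      have e4 := (hσ m).2
      have e5 := (h0 j).1
      have e6 := (hσ₁ m).1
      have e2' := e2
      have e3' := e3
      have e4' := e4
      rw [real_inner_comm, real_inner_comm (p i)] at e2' e3'
      rw [real_inner_comm, real_inner_comm (p j)] at e4'
      intro a b
      fin_cases a <;> fin_cases b <;>
        simp [e2, e3, e4, e2', e3', e4', e5, e6, (h0 i).1])
  have hRi : R (q (σ₀ i)) = p i := hR 0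
  have hRj : R (q (σ₀ j)) = p j := hR 1
  have hRm : R (q (σ m)) = p m := hR 2
  refine ⟨R, exists_equiv_of_dihedral_max (q := fun k => R (q k)) hi hj hm
    (fun x => by rw [span_insert_pair_eq_top hdim hi hj hm]; trivial) hmax σ τ
    (fun k => ⟨?_, ?_, ?_⟩) (fun k => ⟨?_, ?_, ?_⟩)⟩
  · rw [R.norm_map, (hσ₁ k).1]
  · rw [← hRi, R.inner_map_map, (hσ₁ k).2, hRi]
  · rw [← hRj, R.inner_map_map, (hσ k).2, hRj]
  · rw [R.norm_map, (h₁ _ _ (hτ k).1).1]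
  · rw [← hRi, R.inner_map_map, (h₁ _ _ (hτ k).1).2, hRi]
  · rw [← hRm, R.inner_map_map, (hτ k).2, hRm]

/-! ### Norms from squared distances to the center of mass -/

theorem sum_norm_sub_sq_of_sum_eq_zero {V : Type*} [NormedAddCommGroup V] [InnerProductSpace ℝ V]
    {ι : Type*} [Fintype ι] {p : ι → V} (h : ∑ k, p k = 0) (y : V) :
    ∑ k, ‖p k - y‖ ^ 2 = Fintype.card ι * ‖y‖ ^ 2 + ∑ k, ‖p k‖ ^ 2 := by
  simp only [norm_sub_sq_real, Finset.sum_add_distrib, Finset.sum_sub_distrib, ← Finset.mul_sum,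
    ← sum_inner, h, inner_zero_left]
  simp
  ring

theorem real_inner_eq_of_norm_eq {V : Type*} [NormedAddCommGroup V] [InnerProductSpace ℝ V]
    {x y x' y' : V} (hx : ‖x'‖ = ‖x‖) (hy : ‖y'‖ = ‖y‖) (hxy : ‖x' - y'‖ = ‖x - y‖) :
    ⟪x', y'⟫ = ⟪x, y⟫ := by
  rw [real_inner_eq_norm_mul_self_add_norm_mul_self_sub_norm_sub_mul_self_div_two, hx, hy, hxy,
    ← real_inner_eq_norm_mul_self_add_norm_mul_self_sub_norm_sub_mul_self_div_two]

namespace PointCloud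

/-- The center of mass. -/
noncomputable def center (P : PointCloud) : E3 := (P.n : ℝ)⁻¹ • ∑ i, P.pos i

/-- The positions relative to the center of mass. -/
noncomputable def rel (P : PointCloud) (i : Fin P.n) : E3 := P.pos i - P.center

theorem sum_rel (P : PointCloud) : ∑ i, P.rel i = 0 := by
  have : (P.n : ℝ) ≠ 0 := by exact_mod_cast P.n_pos.ne'
  simp only [rel, Finset.sum_sub_distrib, Finset.sum_const, Finset.card_univ, Fintype.card_fin,
    center]
  rw [← Nat.cast_smul_eq_nsmul ℝ, smul_smul, mul_inv_cancel₀ this, one_smul, sub_self]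

theorem coe_d (P : PointCloud) (i j : Fin P.n) : (P.d i j : ℝ) = ‖P.rel i - P.rel j‖ := by
  simp [d, rel, dist_eq_norm]

theorem sum_d_sq (P : PointCloud) (j : Fin P.n) :
    ∑ k, (P.d k j : ℝ) ^ 2 = P.n * ‖P.rel j‖ ^ 2 + ∑ k, ‖P.rel k‖ ^ 2 := by
  simp only [coe_d, sum_norm_sub_sq_of_sum_eq_zero P.sum_rel, Fintype.card_fin]

theorem sum_sum_d_sq (P : PointCloud) :
    ∑ j, ∑ k, (P.d k j : ℝ) ^ 2 = 2 * P.n * ∑ k, ‖P.rel k‖ ^ 2 := by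
  simp only [sum_d_sq, Finset.sum_add_distrib, ← Finset.mul_sum, Finset.sum_const,
    Finset.card_univ, Fintype.card_fin, nsmul_eq_mul]
  ring

/-- The total of all squared distances determines `∑ k, ‖P.rel k‖ ^ 2`; subtracting it from the sum
at one node leaves `n` times the squared norm there. -/
theorem norm_rel_eq {P Q : PointCloud} (hn : Q.n = P.n)
    (hT : ∑ j, ∑ k, (Q.d k j : ℝ) ^ 2 = ∑ j, ∑ k, (P.d k j : ℝ) ^ 2) {j : Fin P.n} {j' : Fin Q.n}
    (h : ∑ k, (Q.d k j' : ℝ) ^ 2 = ∑ k, (P.d k j : ℝ) ^ 2) : ‖Q.rel j'‖ = ‖P.rel j‖ := by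
  have hpos : (0 : ℝ) < P.n := by exact_mod_cast P.n_pos
  have hn' : (Q.n : ℝ) = P.n := by rw [hn]
  rw [sum_sum_d_sq, sum_sum_d_sq, hn'] at hT
  have hT' := mul_left_cancel₀ (by positivity) hT
  rw [sum_d_sq, sum_d_sq, hn', hT', add_left_inj] at h
  exact (pow_left_inj₀ (norm_nonneg _) (norm_nonneg _) two_ne_zero).1
    (mul_left_cancel₀ hpos.ne' h)

theorem isomorphic_of_rel {P Q : PointCloud} (R : E3 ≃ₗᵢ[ℝ] E3) (ρ : Fin P.n ≃ Fin Q.n)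
    (h : ∀ k, Q.rel (ρ k) = R (P.rel k)) : P.Isomorphic Q := by
  refine ⟨ρ, R, Q.center - R P.center, fun k => ?_⟩
  have := h k
  rw [rel, rel, map_sub, sub_eq_iff_eq_add] at this
  rw [this]
  abel

theorem Isomorphic.exists_equiv_d_eq {P Q : PointCloud} (h : P.Isomorphic Q) :
    ∃ σ : Fin P.n ≃ Fin Q.n, ∀ i j, Q.d (σ i) (σ j) = P.d i j := by
  obtain ⟨σ, R, t, h⟩ := h
  refine ⟨σ, fun i j => ?_⟩
  rw [d, d, h, h, nndist_add_right, R.isometry.nndist_eq]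

end PointCloud

/-! ### Invariance of the model -/

namespace GeoNGNN

variable {dx k : ℕ} {M : GeoNGNN dx k}

theorem nbhd_eq_univ (hcutoff : M.rCutoff = ⊤) (P : PointCloud) (j : Fin P.n) :
    M.nbhd P j = Finset.univ := by simp [nbhd, hcutoff]

theorem sub_eq_univ (hsub : M.rSub = ⊤) (P : PointCloud) (i : Fin P.n) :
    M.sub P i = Finset.univ := by simp [sub, hsub]

section Invariance

variable {P Q : PointCloud} {σ : Fin P.n ≃ Fin Q.n} (hσ : ∀ i j, Q.d (σ i) (σ j) = P.d i j)
  {X : Fin P.n → Fin dx → ℝ} {Y : Fin Q.n → Fin dx → ℝ} (hX : ∀ i, Y (σ i) = X i)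
  (hcutoff : M.rCutoff = ⊤) (hsub : M.rSub = ⊤)

include hσ hX hcutoff hsub

theorem inner_equiv (l : ℕ) (i j : Fin P.n) :
    M.inner Q Y l (σ i) (σ j) = M.inner P X l i j := by
  induction l generalizing j with
  | zero => simp [inner, hσ, hX]
  | succ l ih =>
    simp only [inner, nbhd_eq_univ hcutoff, sub_eq_univ hsub, Finset.inter_univ]
    rw [ih, map_univ_eq_of_equiv (g := fun k => (M.inner Q Y l (σ i) k, Q.d k (σ j))) σ
      fun k => by rw [ih, hσ]]

theorem outer_equiv (l : ℕ) (i : Fin P.n) : M.outer Q Y l (σ i) = M.outer P X l i := by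
  induction l generalizing i with
  | zero =>
    simp only [outer, sub_eq_univ hsub]
    rw [map_univ_eq_of_equiv σ fun k => inner_equiv hσ hX hcutoff hsub _ _ _]
  | succ l ih =>
    simp only [outer, nbhd_eq_univ hcutoff]
    rw [ih, map_univ_eq_of_equiv (g := fun k => (M.outer Q Y l k, Q.d (σ i) k)) σ
      fun k => by rw [ih, hσ]]

theorem eval_equiv : M.eval Q Y = M.eval P X := by
  simp only [eval]
  rw [map_univ_eq_of_equiv σ fun k => outer_equiv hσ hX hcutoff hsub _ _]

end Invariance

/-! ### Undoing the layers -/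

section Refinement

variable (hinj : M.AllInjective) (hcutoff : M.rCutoff = ⊤) (hsub : M.rSub = ⊤) {P Q : PointCloud}
  {X : Fin P.n → Fin dx → ℝ} {Y : Fin Q.n → Fin dx → ℝ}

include hinj

theorem exists_equiv_of_eval_eq (h : M.eval P X = M.eval Q Y) :
    ∃ σ : Fin P.n ≃ Fin Q.n, ∀ i, M.outer Q Y M.nOut (σ i) = M.outer P X M.nOut i :=
  exists_equiv_of_map_univ_eq (hinj.output h)

/-- An injective update retains the previous state, so outer layers never lose information and none
is needed. -/
theorem outer_zero_eq {l : ℕ} (hl : l ≤ M.nOut) {i : Fin P.n} {i' : Fin Q.n}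
    (h : M.outer Q Y l i' = M.outer P X l i) : M.outer Q Y 0 i' = M.outer P X 0 i := by
  induction l with
  | zero => exact h
  | succ l ih => exact ih (Nat.le_of_succ_le hl) (Prod.ext_iff.1 (hinj.updateOuter l hl h)).1

include hsub in
theorem exists_equiv_of_outer_zero_eq {i : Fin P.n} {i' : Fin Q.n}
    (h : M.outer Q Y 0 i' = M.outer P X 0 i) :
    ∃ σ : Fin P.n ≃ Fin Q.n, ∀ j, M.inner Q Y M.nIn i' (σ j) = M.inner P X M.nIn i j := by
  simp only [outer, sub_eq_univ hsub] at h
  exact exists_equiv_of_map_univ_eq (hinj.outputInner h).symm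

theorem inner_zero_eq {i j : Fin P.n} {i' j' : Fin Q.n}
    (h : M.inner Q Y 0 i' j' = M.inner P X 0 i j) : Q.d i' j' = P.d i j ∧ (i' = j' ↔ i = j) := by
  have := hinj.initInner h
  simp only [Prod.mk.injEq, decide_eq_decide] at this
  exact this.2

include hcutoff hsub in
theorem inner_succ_eq {l : ℕ} (hl : l < M.nIn) {i j : Fin P.n} {i' j' : Fin Q.n}
    (h : M.inner Q Y (l + 1) i' j' = M.inner P X (l + 1) i j) :
    M.inner Q Y l i' j' = M.inner P X l i j ∧ ∃ σ : Fin P.n ≃ Fin Q.n, ∀ k,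
      M.inner Q Y l i' (σ k) = M.inner P X l i k ∧ Q.d (σ k) j' = P.d k j := by
  obtain ⟨h1, h2⟩ := Prod.ext_iff.1 (hinj.updateInner l hl h)
  refine ⟨h1, ?_⟩
  simp only [nbhd_eq_univ hcutoff, sub_eq_univ hsub, Finset.inter_univ] at h2
  obtain ⟨σ, hσ⟩ := exists_equiv_of_map_univ_eq (hinj.aggrInner l hl h2).symm
  exact ⟨σ, fun k => Prod.ext_iff.1 (hσ k)⟩

theorem inner_eq_of_le {l m : ℕ} (hlm : l ≤ m) (hm : m ≤ M.nIn) {i j : Fin P.n} {i' j' : Fin Q.n}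
    (h : M.inner Q Y m i' j' = M.inner P X m i j) : M.inner Q Y l i' j' = M.inner P X l i j := by
  induction m, hlm using Nat.le_induction with
  | base => exact h
  | succ m _ ih => exact ih (Nat.le_of_succ_le hm) (Prod.ext_iff.1 (hinj.updateInner m hm h)).1

include hcutoff hsub in
theorem isomorphic_of_eval_eq (hin : 3 ≤ M.nIn) (h : M.eval P X = M.eval Q Y) :
    P.Isomorphic Q := by
  obtain ⟨θ, hθ⟩ := exists_equiv_of_eval_eq hinj h
  have hn : Q.n = P.n := by simpa using (Fintype.card_congr θ).symm
  obtain ⟨i, hi⟩ : ∃ i, P.rel i ≠ 0 ∨ ∀ k, P.rel k = 0 := by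
    by_cases h0 : ∀ k, P.rel k = 0
    · exact ⟨⟨0, P.n_pos⟩, Or.inr h0⟩
    · push Not at h0
      exact h0.imp fun _ => Or.inl
  obtain ⟨σ₀, hσ₀⟩ := exists_equiv_of_outer_zero_eq hinj hsub
    (outer_zero_eq hinj le_rfl (hθ i))
  -- The root mark survives in every inner state, so `σ₀` must send root to root.
  have hroot : θ i = σ₀ i :=
    (inner_zero_eq hinj (inner_eq_of_le hinj (Nat.zero_le _) le_rfl (hσ₀ i))).2.2 rfl
  rw [hroot] at hσ₀
  have hS : ∀ j j', M.inner Q Y 1 (σ₀ i) j' = M.inner P X 1 i j →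
      ∑ k, (Q.d k j' : ℝ) ^ 2 = ∑ k, (P.d k j : ℝ) ^ 2 := fun j j' hj => by
    obtain ⟨-, σ, hσ⟩ := inner_succ_eq hinj hcutoff hsub (by omega) hj
    rw [← σ.sum_comp]
    exact Finset.sum_congr rfl fun k _ => by rw [(hσ k).2]
  have hT : ∑ j, ∑ k, (Q.d k j : ℝ) ^ 2 = ∑ j, ∑ k, (P.d k j : ℝ) ^ 2 := by
    rw [← σ₀.sum_comp]
    exact Finset.sum_congr rfl fun j _ =>
      hS _ _ (inner_eq_of_le hinj (by omega) le_rfl (hσ₀ j))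
  have hnorm : ∀ j j', M.inner Q Y 1 (σ₀ i) j' = M.inner P X 1 i j →
      ‖Q.rel j'‖ = ‖P.rel j‖ := fun j j' hj => PointCloud.norm_rel_eq hn hT (hS j j' hj)
  have hdist : ∀ {j k : Fin P.n} {j' k' : Fin Q.n}, Q.d k' j' = P.d k j →
      ‖Q.rel k' - Q.rel j'‖ = ‖P.rel k - P.rel j‖ := fun hd => by
    rw [← PointCloud.coe_d, ← PointCloud.coe_d, hd]
  have hstep : ∀ l, 1 ≤ l → l < M.nIn → ∀ j j',
      M.inner Q Y (l + 1) (σ₀ i) j' = M.inner P X (l + 1) i j →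
      M.inner Q Y l (σ₀ i) j' = M.inner P X l i j ∧ ∃ σ : Fin P.n ≃ Fin Q.n, ∀ k,
        M.inner Q Y l (σ₀ i) (σ k) = M.inner P X l i k ∧
          ⟪Q.rel (σ k), Q.rel j'⟫ = ⟪P.rel k, P.rel j⟫ := by
    intro l hl1 hl j j' hj
    obtain ⟨h1, σ, hσ⟩ := inner_succ_eq hinj hcutoff hsub hl hj
    exact ⟨h1, σ, fun k => ⟨(hσ k).1, real_inner_eq_of_norm_eq
      (hnorm _ _ (inner_eq_of_le hinj hl1 hl.le (hσ k).1))
      (hnorm _ _ (inner_eq_of_le hinj hl1 hl.le h1)) (hdist (hσ k).2)⟩⟩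
  obtain ⟨R, ρ, hρ⟩ := exists_isometry_of_refinement (by simp) (p := P.rel) (q := Q.rel)
    (L₁ := fun j j' => M.inner Q Y 1 (σ₀ i) j' = M.inner P X 1 i j) σ₀ hi
    -- The initial state records the distance to the root; with both norms known, this gives the
    -- inner product.
    (fun j j' hj => ⟨hnorm j j' hj, by
      refine real_inner_eq_of_norm_eq (hnorm j j' hj)
        (hnorm _ _ (inner_eq_of_le hinj (by omega) le_rfl (hσ₀ i))) ?_
      rw [norm_sub_rev, norm_sub_rev (P.rel j)]
      exact hdist (inner_zero_eq hinj (inner_eq_of_le hinj zero_le_one (by omega) hj)).1⟩)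
    (hstep 1 le_rfl (by omega)) (hstep 2 (by omega) (by omega))
    (fun k => inner_eq_of_le hinj hin le_rfl (hσ₀ k))
  exact PointCloud.isomorphic_of_rel R ρ hρ

end Refinement

end GeoNGNN

theorem theorem3 {dx k : ℕ} (M : GeoNGNN dx k) (x₀ : Fin dx → ℝ)
    (hinj : M.AllInjective)
    (hin : 5 ≤ M.nIn)
    (hcutoff : M.rCutoff = ⊤)
    (hsub : M.rSub = ⊤) :
    IsE3Complete (M.onUnlabeled x₀) := by
  refine ⟨fun P Q h => ?_, fun P Q h heq => h ?_⟩
  · obtain ⟨σ, hσ⟩ := h.exists_equiv_d_eq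
    exact (GeoNGNN.eval_equiv (Y := fun _ => x₀) hσ (fun _ => rfl) hcutoff hsub).symm
  · exact GeoNGNN.isomorphic_of_eval_eq hinj hcutoff hsub (by omega) heq
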